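/- Let $n\ge 2$, let $P_1(x,y)=Ax+By$ with $(A,B)\in\mathbb R^2\setminus\{(0,0)\}$, and let $P_n(x,y)$ be a real homogeneous polynomial of degree $n$ (possibly zero). Write $P_1(\theta)=P_1(\cos\theta,\sin\theta)=A\cos\theta+B\sin\theta$, $P_n(\theta)=P_n(\cos\theta,\sin\theta)$ and $\bar P_1(\theta)=A\sin\theta-B\cos\theta$. Consider the rigid system $$x'=-y+x\,(P_1(x,y)+P_n(x,y)),\qquad y'=x+y\,(P_1(x,y)+P_n(x,y)),\tag{S}$$ and its polar equation $$\frac{dr}{d\theta}=r\,\bigl(P_1(\theta)\,r+P_n(\theta)\,r^n\bigr).\tag{E}$$ The origin is a center of (S) if the orbit through every point other than the origin of some neighbourhood of the origin is a closed orbit surrounding the origin; $r=0$ is a center of (E) if all solutions with $|r(0)|$ sufficiently small are defined on $\mathbb R$ and $2\pi$-periodic. Then: 1. The origin is a center of (S), and likewise $r=0$ is a center of (E), if and only if $$\int_0^{2\pi}\bar P_1^{\,j}P_n\,d\theta=0\qquad(j=0,1,\dots,n).$$ 2. If $n=2m+1$ is odd, each of these two center properties holds if and only if $\int_0^{2\pi}\bar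 P_1^{\,2j+1}P_{2m+1}\,d\theta=0$ for $j=0,1,\dots,m$. 3. If $n=2m$ is even, each of these two center properties holds if and only if $\int_0^{2\pi}\bar P_1^{\,2j}P_{2m}\,d\theta=0$ for $j=0,1,\dots,m$. 4. For every $j\ge 0$ whose parity differs from that of $n$, $\int_0^{2\pi}\bar P_1^{\,j}P_n\,d\theta=0$ automatically; exactly $\lfloor n/2\rfloor+1$ of the exponents $j=0,1,\dots,n$ have the parity of $n$. 5. If $r=0$ is a center of (E), then (E) satisfies the composition condition: there are a differentiable $2\pi$-periodic function $u$ and continuous functions $\hat A_1,\hat A_n:\mathbb R\to\mathbb R$ with $P_1(\theta)=u'(\theta)\hat A_1(u(\theta))$ and $P_n(\theta)=u'(\theta)\hat A_n(u(\theta))$ for all $\theta$. Moreover there is a real polynomial $q$ with $P_n(\theta)=\bar P_1'(\theta)\,q(\bar P_1(\theta))$ for all $\theta$. -/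

import Mathlib

open MvPolynomial

noncomputable section

/-- A curve `γ` with period `T` winds around `p`: it avoids `p`, and a continuous choice of its
polar angle about `p` does not return to its initial value after time `T`, that is, the winding
number of `γ` restricted to `[0, T]` about `p` is nonzero. -/
def WindsAround (γ : ℝ → ℝ × ℝ) (T : ℝ) (p : ℝ × ℝ) : Prop :=
  ∃ ρ φ : ℝ → ℝ, Continuous φ ∧
    (∀ t, 0 < ρ t ∧ γ t = p + (ρ t * Real.cos (φ t), ρ t * Real.sin (φ t))) ∧
    φ T ≠ φ 0

/-- The critical point `p` of the planar autonomous system `(x, y)' = F (x, y)` is a center: the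
orbit through every point `q ≠ p` of some neighbourhood of `p` is a closed orbit surrounding `p`. -/
def IsPlanarCenter (F : ℝ × ℝ → ℝ × ℝ) (p : ℝ × ℝ) : Prop :=
  F p = 0 ∧ ∃ U ∈ nhds p, ∀ q ∈ U, q ≠ p →
    ∃ (γ : ℝ → ℝ × ℝ) (T : ℝ), 0 < T ∧ γ 0 = q ∧
      (∀ t, HasDerivAt γ (F (γ t)) t) ∧ Function.Periodic γ T ∧ WindsAround γ T p

/-- `r = 0` is a center of the scalar equation `dr/dθ = f θ r` (with `f` smooth, so that an initial
value determines its solution): all solutions near `r ≡ 0` are `2π`-periodic. -/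
def IsPolarCenter (f : ℝ → ℝ → ℝ) : Prop :=
  ∃ ε > 0, ∀ c : ℝ, |c| < ε →
    ∃ r : ℝ → ℝ, r 0 = c ∧ (∀ θ, HasDerivAt r (f θ (r θ)) θ) ∧
      Function.Periodic r (2 * Real.pi)

/-- The rigid vector field `(-y + x (P₁ + Pₙ), x + y (P₁ + Pₙ))`. -/
def rigidField (P₁ Pₙ : MvPolynomial (Fin 2) ℝ) (v : ℝ × ℝ) : ℝ × ℝ :=
  (-v.2 + v.1 * (eval ![v.1, v.2] P₁ + eval ![v.1, v.2] Pₙ),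
    v.1 + v.2 * (eval ![v.1, v.2] P₁ + eval ![v.1, v.2] Pₙ))

/-- The function `P(θ) = P (cos θ, sin θ)`. -/
def onCircle (P : MvPolynomial (Fin 2) ℝ) (θ : ℝ) : ℝ :=
  eval ![Real.cos θ, Real.sin θ] P

/-- The right-hand side of the polar equation `dr/dθ = r (P₁(θ) r + Pₙ(θ) rⁿ)`. -/
def polarField (P₁ Pₙ : MvPolynomial (Fin 2) ℝ) (n : ℕ) (θ r : ℝ) : ℝ :=
  r * (onCircle P₁ θ * r + onCircle Pₙ θ * r ^ n)

/-- `P̄₁(θ) = A sin θ - B cos θ`, where `A`, `B` are the coefficients of `x`, `y` in `P₁`. -/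
def barP (P₁ : MvPolynomial (Fin 2) ℝ) (θ : ℝ) : ℝ :=
  coeff (Finsupp.single 0 1) P₁ * Real.sin θ - coeff (Finsupp.single 1 1) P₁ * Real.cos θ

/-- The moment `∫₀^{2π} P̄₁ʲ Pₙ dθ`. -/
def moment (P₁ Pₙ : MvPolynomial (Fin 2) ℝ) (j : ℕ) : ℝ :=
  ∫ θ in (0 : ℝ)..(2 * Real.pi), barP P₁ θ ^ j * onCircle Pₙ θ

/-- The composition condition for the coefficient functions `A i` of a polynomial equation
`dr/dθ = r ∑ A i (θ) r ^ (d i)`: all of them factor as `A i = u' · Â i (u)` through one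
differentiable `2π`-periodic function `u`, with continuous `Â i`. (Coefficients that vanish
identically satisfy this with `Â i = 0` and need not be listed.) -/
def CompositionCondition {ι : Type} (A : ι → ℝ → ℝ) : Prop :=
  ∃ u : ℝ → ℝ, Differentiable ℝ u ∧ Function.Periodic u (2 * Real.pi) ∧
    ∃ Ahat : ι → ℝ → ℝ, ∀ i, Continuous (Ahat i) ∧
      ∀ θ, A i θ = deriv u θ * Ahat i (u θ)

end

/-! Write `s` for `barP P₁`. Then `s' = P₁(θ)`, and everything turns on whether `Pₙ(θ)` is `s'`
times a polynomial in `s`.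

Sufficiency. On the circle `Pₙ = f(s) + s' g(s)` with `deg f ≤ n` (`exists_onCircle_eq`). The second
summand contributes to no moment, since `s` is periodic. If the moments up to `n` vanish, `f(s)` is
orthogonal to `1, s, …, sⁿ`, hence to itself, so `f(s) = 0`. The polar equation is then the pullback
under `s` of `dR/ds = R (R + g(s) Rⁿ)`, whose small solutions exist over the whole range of `s`;
composed with `s` they are periodic. The same factorization gives the composition condition.

Necessity. Either kind of center forces small positive polar solutions to return after one turn
(`HasTrivialReturn`). For such an `r`, put `E = 1/δ - s - 1/r` with `δ` chosen so that `E(0) = 0`.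
Then `E' = Pₙ r^(n-1)` and `E(2π) = 0`, so both `∫ E'` and `∫ E E'` vanish. Expanding `r` about `δ /
(1 - δ s)`, the first correction is to leading order a multiple of `∫ E E'` and drops out, leaving
`∫ Pₙ (1 - δ s)^(-(n-1)) = O(δ^(n+1))` (`exists_abs_integral_geom_sum_le`, with a truncated
geometric series). The Taylor coefficients of `(1 - x)^(-(n-1))` are positive because `n ≥ 2`, so
every moment up to `n` vanishes. Without the cancellation the error would be `O(δⁿ)` and the moment
of order `n` would escape. -/

noncomputable section

/-! ### Trigonometric form of the polynomials and parity of the moments -/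

section Trigonometry

variable {P₁ Pₙ : MvPolynomial (Fin 2) ℝ} {n : ℕ}

theorem eq_linear_of_isHomogeneous_one (hP₁ : P₁.IsHomogeneous 1) :
    P₁ = C (coeff (Finsupp.single 0 1) P₁) * X 0 + C (coeff (Finsupp.single 1 1) P₁) * X 1 := by
  have h : P₁ ∈ homogeneousSubmodule (Fin 2) ℝ 1 := hP₁
  rw [homogeneousSubmodule_one_eq_span_X] at h
  rw [Submodule.mem_span_range_iff_exists_fun] at h
  obtain ⟨c, rfl⟩ := h
  simp [Fin.sum_univ_two, smul_eq_C_mul, coeff_C_mul, coeff_X, Finsupp.single_left_inj]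

theorem onCircle_linear (hP₁ : P₁.IsHomogeneous 1) (θ : ℝ) :
    onCircle P₁ θ = coeff (Finsupp.single 0 1) P₁ * Real.cos θ +
      coeff (Finsupp.single 1 1) P₁ * Real.sin θ := by
  unfold onCircle
  conv_lhs => rw [eq_linear_of_isHomogeneous_one hP₁]
  simp

theorem hasDerivAt_barP (hP₁ : P₁.IsHomogeneous 1) (θ : ℝ) :
    HasDerivAt (barP P₁) (onCircle P₁ θ) θ := by
  rw [onCircle_linear hP₁]
  have := ((Real.hasDerivAt_sin θ).const_mul (coeff (Finsupp.single 0 1) P₁)).sub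
    ((Real.hasDerivAt_cos θ).const_mul (coeff (Finsupp.single 1 1) P₁))
  convert! this using 1
  ring

theorem continuous_barP : Continuous (barP P₁) := by
  unfold barP
  fun_prop

theorem barP_periodic : Function.Periodic (barP P₁) (2 * Real.pi) := fun θ => by simp [barP]

theorem barP_add_pi (θ : ℝ) : barP P₁ (θ + Real.pi) = -barP P₁ θ := by
  simp [barP]; ring

/-- Strictness keeps the values of `barP P₁` interior to `[-S, S]`, where solutions over that
interval have two-sided derivatives. -/
theorem abs_barP_le (P₁ : MvPolynomial (Fin 2) ℝ) :
    ∃ S > 0, ∀ θ, |barP P₁ θ| < S := by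
  refine ⟨|coeff (Finsupp.single 0 1) P₁| + |coeff (Finsupp.single 1 1) P₁| + 1, by positivity,
    fun θ => ?_⟩
  have h1 : |coeff (Finsupp.single 0 1) P₁ * Real.sin θ| ≤ |coeff (Finsupp.single 0 1) P₁| := by
    rw [abs_mul]; exact mul_le_of_le_one_right (abs_nonneg _) (Real.abs_sin_le_one θ)
  have h2 : |coeff (Finsupp.single 1 1) P₁ * Real.cos θ| ≤ |coeff (Finsupp.single 1 1) P₁| := by
    rw [abs_mul]; exact mul_le_of_le_one_right (abs_nonneg _) (Real.abs_cos_le_one θ)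
  have := abs_sub (coeff (Finsupp.single 0 1) P₁ * Real.sin θ)
    (coeff (Finsupp.single 1 1) P₁ * Real.cos θ)
  unfold barP
  linarith

theorem continuous_onCircle (P : MvPolynomial (Fin 2) ℝ) : Continuous (onCircle P) := by
  unfold onCircle
  have h : Continuous fun θ : ℝ => ![Real.cos θ, Real.sin θ] := by
    refine continuous_pi fun i => ?_
    fin_cases i
    · exact Real.continuous_cos
    · exact Real.continuous_sin
  exact (MvPolynomial.continuous_eval P).comp h

theorem onCircle_periodic (P : MvPolynomial (Fin 2) ℝ) :
    Function.Periodic (onCircle P) (2 * Real.pi) := fun θ => by simp [onCircle]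

theorem exists_abs_onCircle_le (P : MvPolynomial (Fin 2) ℝ) :
    ∃ M > 0, ∀ θ, |onCircle P θ| ≤ M := by
  have hper := (onCircle_periodic P).compact_of_continuous (by positivity) (continuous_onCircle P)
  obtain ⟨M, hM⟩ := hper.isBounded.exists_norm_le
  exact ⟨max M 1, by positivity, fun θ => (hM _ ⟨θ, rfl⟩).trans (le_max_left _ _)⟩

theorem MvPolynomial.IsHomogeneous.apply_zero_add_apply_one {P : MvPolynomial (Fin 2) ℝ} {k : ℕ}
    (hP : P.IsHomogeneous k) {d : Fin 2 →₀ ℕ} (hd : d ∈ P.support) : d 0 + d 1 = k := by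
  rw [hP.degree_eq_sum_deg_support hd, ← Fin.sum_univ_two]
  exact (Finset.sum_subset (Finset.subset_univ _) (by simp)).symm

theorem eval_smul_of_isHomogeneous {P : MvPolynomial (Fin 2) ℝ} {k : ℕ} (hP : P.IsHomogeneous k)
    (r x y : ℝ) : eval ![r * x, r * y] P = r ^ k * eval ![x, y] P := by
  rw [eval_eq', eval_eq', Finset.mul_sum]
  refine Finset.sum_congr rfl fun d hd => ?_
  rw [← hP.apply_zero_add_apply_one hd]
  simp [Fin.prod_univ_two, mul_pow, pow_add]
  ring

theorem onCircle_add_pi (hPₙ : Pₙ.IsHomogeneous n) (θ : ℝ) :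
    onCircle Pₙ (θ + Real.pi) = (-1) ^ n * onCircle Pₙ θ := by
  have := eval_smul_of_isHomogeneous hPₙ (-1) (Real.cos θ) (Real.sin θ)
  simpa [onCircle] using this

/-- The moments whose exponent has the parity opposite to that of `n` vanish. -/
theorem moment_eq_zero_of_parity_ne (hPₙ : Pₙ.IsHomogeneous n) {j : ℕ} (hj : j % 2 ≠ n % 2) :
    moment P₁ Pₙ j = 0 := by
  have hper : Function.Periodic (fun θ => barP P₁ θ ^ j * onCircle Pₙ θ) (2 * Real.pi) :=
    fun θ => by simp only [barP_periodic θ, onCircle_periodic Pₙ θ]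
  -- The half turn `θ ↦ θ + π` preserves the integral over a period and multiplies the integrand by
  -- `(-1)^(j+n) = -1`.
  have h1 := hper.intervalIntegral_add_eq Real.pi 0
  have h2 : ∫ θ in (0 : ℝ)..(2 * Real.pi),
      barP P₁ (θ + Real.pi) ^ j * onCircle Pₙ (θ + Real.pi) = -moment P₁ Pₙ j := by
    rw [moment, ← intervalIntegral.integral_neg]
    congr 1
    ext θ
    have hodd : (-1 : ℝ) ^ j * (-1) ^ n = -1 := by
      rw [← pow_add]
      exact Odd.neg_one_pow (by rw [Nat.odd_iff]; omega)
    rw [barP_add_pi, onCircle_add_pi hPₙ, neg_pow]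
    linear_combination (barP P₁ θ ^ j * onCircle Pₙ θ) * hodd
  rw [intervalIntegral.integral_comp_add_right (fun θ => barP P₁ θ ^ j * onCircle Pₙ θ) Real.pi]
    at h2
  rw [zero_add, add_comm (2 * Real.pi), h1, zero_add] at h2
  change moment P₁ Pₙ j = _ at h2
  linarith

/-- On the circle, a polynomial of degree `n` is `f (P̄₁) + P₁ g (P̄₁)` with `deg f ≤ n`. -/
theorem exists_onCircle_eq (hP₁ : P₁.IsHomogeneous 1) (hP₁_ne : P₁ ≠ 0)
    (hPₙ : Pₙ.IsHomogeneous n) :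
    ∃ f g : Polynomial ℝ, f.natDegree ≤ n ∧
      ∀ θ, onCircle Pₙ θ = f.eval (barP P₁ θ) + onCircle P₁ θ * g.eval (barP P₁ θ) := by
  set A := coeff (Finsupp.single 0 1) P₁ with hA
  set B := coeff (Finsupp.single 1 1) P₁ with hB
  have hR : A ^ 2 + B ^ 2 ≠ 0 := by
    intro h
    have hA0 : A = 0 := by nlinarith [sq_nonneg A, sq_nonneg B]
    have hB0 : B = 0 := by nlinarith [sq_nonneg A, sq_nonneg B]
    apply hP₁_ne
    rw [eq_linear_of_isHomogeneous_one hP₁, ← hA, ← hB, hA0, hB0]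
    simp
  have hs : ∀ θ, barP P₁ θ = A * Real.sin θ - B * Real.cos θ := fun θ => rfl
  have hc : ∀ θ, onCircle P₁ θ = A * Real.cos θ + B * Real.sin θ := onCircle_linear hP₁
  have hsc : ∀ θ, onCircle P₁ θ ^ 2 = (A ^ 2 + B ^ 2) - barP P₁ θ ^ 2 := fun θ => by
    rw [hs, hc]
    linear_combination (A ^ 2 + B ^ 2) * Real.sin_sq_add_cos_sq θ
  -- The bound on `X * g` says `deg g ≤ k - 1` without truncated subtraction and forces `g = 0` when
  -- `k = 0`; it keeps the degree of `f` under control when multiplying by `P₁`.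
  let V : ℕ → (ℝ → ℝ) → Prop := fun k F => ∃ f g : Polynomial ℝ, f.natDegree ≤ k ∧
    (Polynomial.X * g).natDegree ≤ k ∧
    ∀ θ, F θ = f.eval (barP P₁ θ) + onCircle P₁ θ * g.eval (barP P₁ θ)
  have hadd : ∀ k F G, V k F → V k G → V k (F + G) := by
    rintro k F G ⟨f, g, h1, h2, h3⟩ ⟨f', g', h1', h2', h3'⟩
    refine ⟨f + f', g + g', Polynomial.natDegree_add_le_of_degree_le h1 h1', ?_, fun θ => ?_⟩
    · rw [mul_add]; exact Polynomial.natDegree_add_le_of_degree_le h2 h2'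
    · simp [h3, h3']; ring
  have hsmul : ∀ k F (a : ℝ), V k F → V k (fun θ => a * F θ) := by
    rintro k F a ⟨f, g, h1, h2, h3⟩
    refine ⟨Polynomial.C a * f, Polynomial.C a * g, (Polynomial.natDegree_C_mul_le _ _).trans h1,
      ?_, fun θ => ?_⟩
    · rw [mul_left_comm]; exact (Polynomial.natDegree_C_mul_le _ _).trans h2
    · simp [h3]; ring
  have hmuls : ∀ k F, V k F → V (k + 1) (fun θ => barP P₁ θ * F θ) := by
    rintro k F ⟨f, g, h1, h2, h3⟩
    refine ⟨Polynomial.X * f, Polynomial.X * g, ?_, ?_, fun θ => ?_⟩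
    · exact Polynomial.natDegree_mul_le.trans (by rw [Polynomial.natDegree_X]; omega)
    · exact Polynomial.natDegree_mul_le.trans (by rw [Polynomial.natDegree_X]; omega)
    · simp [h3]; ring
  have hmulc : ∀ k F, V k F → V (k + 1) (fun θ => onCircle P₁ θ * F θ) := by
    rintro k F ⟨f, g, h1, h2, h3⟩
    -- Multiplication by `P₁` swaps the two parts, with `P₁² = A² + B² - s²` reducing the square.
    refine ⟨Polynomial.C (A ^ 2 + B ^ 2) * g - Polynomial.X * (Polynomial.X * g), f, ?_, ?_,
      fun θ => ?_⟩
    · refine (Polynomial.natDegree_sub_le _ _).trans (max_le ?_ ?_)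
      · refine (Polynomial.natDegree_C_mul_le _ _).trans ?_
        rcases eq_or_ne g 0 with rfl | hg
        · simp
        · rw [Polynomial.natDegree_X_mul hg] at h2; omega
      · exact Polynomial.natDegree_mul_le.trans (by rw [Polynomial.natDegree_X]; omega)
    · exact Polynomial.natDegree_mul_le.trans (by rw [Polynomial.natDegree_X]; omega)
    · simp only [h3, Polynomial.eval_sub, Polynomial.eval_mul, Polynomial.eval_C,
        Polynomial.eval_X]
      linear_combination g.eval (barP P₁ θ) * hsc θ
  have hcos : ∀ k F, V k F → V (k + 1) (fun θ => Real.cos θ * F θ) := by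
    intro k F hF
    -- Inverting the rotation: `(A² + B²) cos θ = A P₁ - B s`, and below `(A² + B²) sin θ = A s + B
    -- P₁`.
    have := hsmul _ _ (A ^ 2 + B ^ 2)⁻¹ (hadd _ _ _ (hsmul _ _ A (hmulc k F hF))
      (hsmul _ _ (-B) (hmuls k F hF)))
    convert this using 2 with θ
    simp only [Pi.add_apply, hs, hc]
    field_simp
    ring
  have hsin : ∀ k F, V k F → V (k + 1) (fun θ => Real.sin θ * F θ) := by
    intro k F hF
    have := hsmul _ _ (A ^ 2 + B ^ 2)⁻¹ (hadd _ _ _ (hsmul _ _ A (hmuls k F hF))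
      (hsmul _ _ B (hmulc k F hF)))
    convert this using 2 with θ
    simp only [Pi.add_apply, hs, hc]
    field_simp
    ring
  have hone : V 0 (fun _ => 1) := ⟨1, 0, by simp, by simp, fun θ => by simp⟩
  have hmono : ∀ a b : ℕ, V (a + b) (fun θ => Real.cos θ ^ a * Real.sin θ ^ b) := by
    intro a b
    induction a with
    | zero =>
      induction b with
      | zero => simpa using hone
      | succ b ih =>
        rw [← add_assoc]
        convert hsin _ _ ih using 2 with θ
        ring
    | succ a ih =>
      rw [add_right_comm]
      convert hcos _ _ ih using 2 with θ
      ring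
  have hsum : ∀ s : Finset (Fin 2 →₀ ℕ), s ⊆ Pₙ.support →
      V n (fun θ => ∑ d ∈ s, coeff d Pₙ * (Real.cos θ ^ d 0 * Real.sin θ ^ d 1)) := by
    intro s
    induction s using Finset.induction_on with
    | empty => exact fun _ => ⟨0, 0, by simp, by simp, fun θ => by simp⟩
    | insert d s hd ih =>
      intro hsub
      have h1 := hsmul _ _ (coeff d Pₙ) (hmono (d 0) (d 1))
      rw [hPₙ.apply_zero_add_apply_one (hsub (Finset.mem_insert_self _ _))] at h1
      have h2 := hadd _ _ _ h1 (ih fun x hx => hsub (Finset.mem_insert_of_mem hx))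
      convert h2 using 2 with θ
      rw [Finset.sum_insert hd]
      rfl
  obtain ⟨f, g, h1, -, h3⟩ := hsum _ subset_rfl
  refine ⟨f, g, h1, fun θ => ?_⟩
  rw [← h3, onCircle, eval_eq']
  simp [Fin.prod_univ_two]

theorem card_filter_parity (n : ℕ) :
    ((Finset.range (n + 1)).filter (fun j => j % 2 = n % 2)).card = n / 2 + 1 := by
  have : (Finset.range (n + 1)).filter (fun j => j % 2 = n % 2) =
      (Finset.range (n / 2 + 1)).image (fun i => 2 * i + n % 2) := by
    ext j
    simp only [Finset.mem_filter, Finset.mem_range, Finset.mem_image]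
    constructor
    · rintro ⟨h1, h2⟩
      exact ⟨j / 2, by omega, by omega⟩
    · rintro ⟨i, h1, rfl⟩
      omega
  rw [this, Finset.card_image_of_injective _ (fun a b h => by simpa using h), Finset.card_range]

end Trigonometry

/-! ### Existence and size of small solutions -/

section SmallSolutions

/-- The Picard-Lindelöf theorem, together with the bound on the solution. -/
theorem IsPicardLindelof.exists_mem_closedBall_hasDerivWithinAt {E : Type*} [NormedAddCommGroup E]
    [NormedSpace ℝ E] [CompleteSpace E] {f : ℝ → E → E} {tmin tmax : ℝ} {t₀ : Set.Icc tmin tmax}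
    {x₀ : E} {a L K : NNReal} (hf : IsPicardLindelof f t₀ x₀ a 0 L K) :
    ∃ α : ℝ → E, α t₀ = x₀ ∧ Continuous α ∧ (∀ t, α t ∈ Metric.closedBall x₀ a) ∧
      ∀ t ∈ Set.Icc tmin tmax, HasDerivWithinAt α (f t (α t)) (Set.Icc tmin tmax) t := by
  have hx : x₀ ∈ Metric.closedBall x₀ ((0 : NNReal) : ℝ) := Metric.mem_closedBall_self le_rfl
  obtain ⟨α, hα⟩ := ODE.FunSpace.exists_isFixedPt_next hf hx
  have hmem : ∀ t, α.compProj t ∈ Metric.closedBall x₀ a := fun t =>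
    α.compProj_mem_closedBall hf.mul_max_le
  refine ⟨α.compProj, by rw [ODE.FunSpace.compProj_val, ← hα, ODE.FunSpace.next_apply₀],
    α.continuous_compProj, hmem,
    fun t ht => ?_⟩
  apply (ODE.hasDerivWithinAt_picard_Icc t₀.2 hf.continuousOn_uncurry
    α.continuous_compProj.continuousOn (fun t' _ => hmem t') x₀ ht).congr_of_mem _ ht
  intro t' ht'
  nth_rw 1 [← hα]
  rw [ODE.FunSpace.compProj_of_mem ht', ODE.FunSpace.next_apply]

/-- Small initial values have solutions on a prescribed compact interval, which stay comparable to
the initial value. -/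
theorem exists_small_solution {a b : ℝ → ℝ} (ha : Continuous a) (hb : Continuous b) (n : ℕ)
    (hn : 1 ≤ n) {L : ℝ} (hL : 0 < L) :
    ∃ ε > 0, ∀ ρ : ℝ, |ρ| < ε → ∀ t₀ ∈ Set.Icc (-L) L, ∃ w : ℝ → ℝ, w t₀ = 1 ∧ Continuous w ∧
      (∀ t, w t ∈ Set.Icc (1 / 2 : ℝ) (3 / 2)) ∧
      ∀ t ∈ Set.Ioo (-L) L,
        HasDerivAt (fun t => ρ * w t) (ρ * w t * (a t * (ρ * w t) + b t * (ρ * w t) ^ n)) t := by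
  obtain ⟨Ma, hMa⟩ := (isCompact_Icc (a := -L) (b := L)).exists_bound_of_continuousOn ha.continuousOn
  obtain ⟨Mb, hMb⟩ := (isCompact_Icc (a := -L) (b := L)).exists_bound_of_continuousOn hb.continuousOn
  obtain ⟨M, hM0, hMa', hMb'⟩ : ∃ M > 0, (∀ t ∈ Set.Icc (-L) L, |a t| ≤ M) ∧
      ∀ t ∈ Set.Icc (-L) L, |b t| ≤ M :=
    ⟨max 1 (max Ma Mb), by positivity, fun t ht => (hMa t ht).trans (by simp),
      fun t ht => (hMb t ht).trans (by simp)⟩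
  -- While `w` stays in `[1/2, 3/2]`, its speed is at most `5 M |ρ|`, so over a time of at most `2
  -- L` it moves by at most `10 M L |ρ| ≤ 1/2`. The bound `|ρ| < 1/2` gives `|ρ w| ≤ 1`, so that the
  -- `n`-th power is dominated by the first.
  refine ⟨min (1 / 2) (1 / (20 * M * L)), by positivity, fun ρ hρ t₀ ht₀ => ?_⟩
  have hρ1 : |ρ| < 1 / 2 := hρ.trans_le (min_le_left _ _)
  have hρ2 : |ρ| * (20 * M * L) < 1 := by
    have := hρ.trans_le (min_le_right _ _)
    rwa [lt_div_iff₀ (by positivity)] at this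
  let f : ℝ → ℝ → ℝ := fun t w => w * (a t * (ρ * w) + b t * (ρ * w) ^ n)
  have hball : ∀ w ∈ Metric.closedBall (1 : ℝ) (1 / 2 : NNReal), 1 / 2 ≤ w ∧ w ≤ 3 / 2 := by
    intro w hw
    rw [Metric.mem_closedBall, Real.dist_eq, abs_le] at hw
    norm_num at hw
    constructor <;> linarith
  have hf : IsPicardLindelof f (tmin := -L) (tmax := L) ⟨t₀, ht₀⟩ 1 (1 / 2) 0
      ⟨5 * M * |ρ|, by positivity⟩
      ⟨M * (3 * |ρ|) + M * (|ρ| ^ n * ((n + 1) * (3 / 2) ^ n)), by positivity⟩ := by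
    refine ⟨fun t ht => LipschitzOnWith.of_dist_le_mul fun x hx y hy => ?_, fun x _ => ?_,
      fun t ht w hw => ?_, ?_⟩
    · obtain ⟨hx1, hx2⟩ := hball x hx
      obtain ⟨hy1, hy2⟩ := hball y hy
      have hmax : max |x| |y| ≤ 3 / 2 := by
        rw [abs_of_pos (by linarith), abs_of_pos (by linarith)]; exact max_le hx2 hy2
      have e : f t x - f t y =
          a t * (ρ * (x ^ 2 - y ^ 2)) + b t * (ρ ^ n * (x ^ (n + 1) - y ^ (n + 1))) := by
        simp only [f]; ring
      have h2 : |x ^ 2 - y ^ 2| ≤ 3 * |x - y| := by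
        have := abs_pow_sub_pow_le (a := x) (b := y) (n := 2)
        norm_num at this
        nlinarith [abs_nonneg (x - y)]
      have hn1 : |x ^ (n + 1) - y ^ (n + 1)| ≤ ((n + 1) * (3 / 2) ^ n) * |x - y| := by
        have := abs_pow_sub_pow_le (a := x) (b := y) (n := n + 1)
        rw [Nat.add_sub_cancel] at this
        push_cast at this
        refine this.trans ?_
        rw [mul_assoc, mul_comm]
        gcongr
      rw [Real.dist_eq, Real.dist_eq, e]
      change _ ≤ (M * (3 * |ρ|) + M * (|ρ| ^ n * ((n + 1) * (3 / 2) ^ n))) * |x - y|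
      calc _ ≤ |a t| * (|ρ| * |x ^ 2 - y ^ 2|) + |b t| * (|ρ| ^ n * |x ^ (n + 1) - y ^ (n + 1)|) := by
            refine (abs_add_le _ _).trans_eq ?_
            simp only [abs_mul, abs_pow]
        _ ≤ M * (|ρ| * (3 * |x - y|)) + M * (|ρ| ^ n * (((n + 1) * (3 / 2) ^ n) * |x - y|)) := by
            gcongr
            · exact hMa' t ht
            · exact hMb' t ht
        _ = _ := by ring
    · exact Continuous.continuousOn (by fun_prop)
    · obtain ⟨hw1, hw2⟩ := hball w hw
      have hw0 : |w| ≤ 3 / 2 := by rwa [abs_of_pos (by linarith)]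
      have h1 : |ρ * w| ≤ 3 / 2 * |ρ| := by
        rw [abs_mul, mul_comm]; gcongr
      have h3 : |ρ * w| ^ n ≤ 3 / 2 * |ρ| :=
        (pow_le_of_le_one (abs_nonneg _) (by linarith) (by omega)).trans h1
      change |w * (a t * (ρ * w) + b t * (ρ * w) ^ n)| ≤ 5 * M * |ρ|
      calc _ ≤ |w| * (|a t| * |ρ * w| + |b t| * |ρ * w| ^ n) := by
            rw [abs_mul]
            gcongr
            refine (abs_add_le _ _).trans_eq ?_
            rw [abs_mul, abs_mul _ ((ρ * w) ^ n), abs_pow]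
        _ ≤ 3 / 2 * (M * (3 / 2 * |ρ|) + M * (3 / 2 * |ρ|)) := by
            gcongr
            · exact hMa' t ht
            · exact hMb' t ht
        _ ≤ 5 * M * |ρ| := by nlinarith [mul_nonneg hM0.le (abs_nonneg ρ)]
    · change 5 * M * |ρ| * max (L - t₀) (t₀ - -L) ≤ ((1 / 2 : NNReal) : ℝ) - ((0 : NNReal) : ℝ)
      have : max (L - t₀) (t₀ - -L) ≤ 2 * L := max_le (by linarith [ht₀.1]) (by linarith [ht₀.2])
      calc _ ≤ 5 * M * |ρ| * (2 * L) := by gcongr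
        _ ≤ _ := by norm_num; linarith
  obtain ⟨α, hα0, hαc, hmem, hα⟩ := hf.exists_mem_closedBall_hasDerivWithinAt
  refine ⟨α, hα0, hαc, fun t => hball _ (hmem t), fun t ht => ?_⟩
  convert! ((hα t (Set.Ioo_subset_Icc_self ht)).hasDerivAt
    (Icc_mem_nhds ht.1 ht.2)).const_mul ρ using 1
  simp only [f]
  ring

end SmallSolutions

/-! ### Scalar linear equations -/

section LinearEquation

/-- Solutions of `d' = h d` are exponentials. -/
theorem eq_exp_integral_of_hasDerivAt_Ioo {d h : ℝ → ℝ} {L : ℝ} (hh : Continuous h)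
    (hd : ∀ t ∈ Set.Ioo (-L) L, HasDerivAt d (h t * d t) t) {t : ℝ} (ht : t ∈ Set.Ioo (-L) L) :
    d t = d 0 * Real.exp (∫ τ in (0 : ℝ)..t, h τ) := by
  have hH : ∀ t, HasDerivAt (fun t => ∫ τ in (0 : ℝ)..t, h τ) (h t) t := fun t =>
    intervalIntegral.integral_hasDerivAt_right (hh.intervalIntegrable _ _)
      (hh.stronglyMeasurableAtFilter _ _) hh.continuousAt
  have hg : ∀ t ∈ Set.Ioo (-L) L,
      HasDerivAt (fun t => d t * Real.exp (-∫ τ in (0 : ℝ)..t, h τ)) 0 t := fun t ht => by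
    convert! (hd t ht).mul (hH t).neg.exp using 1
    ring
  have h0 : (0 : ℝ) ∈ Set.Ioo (-L) L := ⟨by linarith [ht.1, ht.2], by linarith [ht.1, ht.2]⟩
  have := isOpen_Ioo.is_const_of_deriv_eq_zero isPreconnected_Ioo
    (fun t ht => (hg t ht).differentiableAt.differentiableWithinAt)
    (fun t ht => (hg t ht).deriv) ht h0
  simp only [intervalIntegral.integral_same, neg_zero, Real.exp_zero, mul_one] at this
  rw [← this, mul_assoc, ← Real.exp_add]
  simp

theorem eq_exp_integral_of_hasDerivAt {d h : ℝ → ℝ} (hh : Continuous h)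
    (hd : ∀ t, HasDerivAt d (h t * d t) t) (t : ℝ) :
    d t = d 0 * Real.exp (∫ τ in (0 : ℝ)..t, h τ) :=
  eq_exp_integral_of_hasDerivAt_Ioo (L := |t| + 1) hh (fun t _ => hd t)
    ⟨by linarith [neg_abs_le t], by linarith [le_abs_self t]⟩

end LinearEquation

/-! ### Vanishing moments imply a center -/

section Sufficiency

variable {P₁ Pₙ : MvPolynomial (Fin 2) ℝ} {n : ℕ}

theorem integral_onCircle_mul_comp_barP (hP₁ : P₁.IsHomogeneous 1) {G : ℝ → ℝ}
    (hG : Continuous G) :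
    ∫ θ in (0 : ℝ)..(2 * Real.pi), G (barP P₁ θ) * onCircle P₁ θ = 0 := by
  have := intervalIntegral.integral_comp_mul_deriv (a := 0) (b := 2 * Real.pi)
    (fun θ _ => hasDerivAt_barP hP₁ θ) (continuous_onCircle P₁).continuousOn hG
  have hper : barP P₁ (2 * Real.pi) = barP P₁ 0 := by simpa using barP_periodic (P₁ := P₁) 0
  rwa [hper, intervalIntegral.integral_same] at this

theorem integral_eval_barP_mul {F : ℝ → ℝ} (hF : Continuous F) (p : Polynomial ℝ) :
    ∫ θ in (0 : ℝ)..(2 * Real.pi), p.eval (barP P₁ θ) * F θ =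
      ∑ j ∈ Finset.range (p.natDegree + 1),
        p.coeff j * ∫ θ in (0 : ℝ)..(2 * Real.pi), barP P₁ θ ^ j * F θ := by
  have hs : Continuous (barP P₁) := continuous_barP
  simp_rw [Polynomial.eval_eq_sum_range, Finset.sum_mul, mul_assoc]
  rw [intervalIntegral.integral_finsetSum]
  · simp_rw [intervalIntegral.integral_const_mul]
  · intro j _
    exact Continuous.intervalIntegrable (by fun_prop) _ _

/-- The remainder `f(s)` has the same moments as `Pₙ`. Since `deg f ≤ n`, the integral of `f(s)²` is
a combination of vanishing moments. -/
theorem exists_onCircle_eq_mul_of_moment_eq_zero (hP₁ : P₁.IsHomogeneous 1) (hP₁_ne : P₁ ≠ 0)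
    (hPₙ : Pₙ.IsHomogeneous n) (hmom : ∀ j ≤ n, moment P₁ Pₙ j = 0) :
    ∃ q : Polynomial ℝ, ∀ θ, onCircle Pₙ θ = onCircle P₁ θ * q.eval (barP P₁ θ) := by
  obtain ⟨f, g, hf, hfg⟩ := exists_onCircle_eq hP₁ hP₁_ne hPₙ
  have hs : Continuous (barP P₁) := continuous_barP
  have hc : Continuous (onCircle P₁) := continuous_onCircle P₁
  have hfs : Continuous fun θ => f.eval (barP P₁ θ) := f.continuous.comp hs
  have hgs : Continuous fun θ => g.eval (barP P₁ θ) := g.continuous.comp hs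
  have h0 : ∀ j ≤ n, ∫ θ in (0 : ℝ)..(2 * Real.pi), barP P₁ θ ^ j * f.eval (barP P₁ θ) = 0 := by
    intro j hj
    have h1 := integral_onCircle_mul_comp_barP hP₁ (G := fun x => x ^ j * g.eval x)
      ((continuous_pow j).mul g.continuous)
    have h2 := hmom j hj
    have h3 : moment P₁ Pₙ j = (∫ θ in (0 : ℝ)..(2 * Real.pi), barP P₁ θ ^ j * f.eval (barP P₁ θ)) +
        ∫ θ in (0 : ℝ)..(2 * Real.pi), barP P₁ θ ^ j * g.eval (barP P₁ θ) * onCircle P₁ θ := by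
      rw [moment, ← intervalIntegral.integral_add]
      · congr 1
        ext θ
        rw [hfg]; ring
      · exact Continuous.intervalIntegrable (by fun_prop) _ _
      · exact Continuous.intervalIntegrable (by fun_prop) _ _
    linarith
  have hsq : ∫ θ in (0 : ℝ)..(2 * Real.pi), f.eval (barP P₁ θ) * f.eval (barP P₁ θ) = 0 := by
    rw [integral_eval_barP_mul hfs]
    refine Finset.sum_eq_zero fun j hj => ?_
    rw [h0 j (by have := Finset.mem_range.1 hj; omega), mul_zero]
  have hf0 : ∀ θ, f.eval (barP P₁ θ) = 0 := by
    intro θ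
    by_contra hne
    -- The period is moved to start at `θ`, so that the point where `f(s)` is nonzero lies in the
    -- interval of integration.
    have hper : Function.Periodic (fun θ => f.eval (barP P₁ θ) * f.eval (barP P₁ θ))
        (2 * Real.pi) := fun θ => by simp only [barP_periodic θ]
    have h1 := hper.intervalIntegral_add_eq θ 0
    rw [zero_add, hsq] at h1
    have h2 := intervalIntegral.integral_lt_integral_of_continuousOn_of_le_of_exists_lt
      (f := fun _ => (0 : ℝ)) (g := fun θ => f.eval (barP P₁ θ) * f.eval (barP P₁ θ))
      (a := θ) (b := θ + 2 * Real.pi) (by linarith [Real.pi_pos]) continuousOn_const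
      (hfs.mul hfs).continuousOn (fun x _ => mul_self_nonneg _)
      ⟨θ, ⟨le_rfl, by linarith [Real.pi_pos]⟩, mul_self_pos.2 hne⟩
    rw [h1] at h2
    simp at h2
  exact ⟨g, fun θ => by rw [hfg, hf0, zero_add]⟩

/-- If `Pₙ = P₁ q (P̄₁)`, the small solutions of the polar equation are functions of `P̄₁`. -/
theorem exists_periodic_solution (hn : 1 ≤ n) (hP₁ : P₁.IsHomogeneous 1) {q : Polynomial ℝ}
    (hq : ∀ θ, onCircle Pₙ θ = onCircle P₁ θ * q.eval (barP P₁ θ)) :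
    ∃ ε > 0, ∀ ρ : ℝ, |ρ| < ε → ∀ θ₀ : ℝ, ∃ w : ℝ → ℝ, w θ₀ = 1 ∧ (∀ θ, 0 < w θ) ∧
      Function.Periodic w (2 * Real.pi) ∧
      ∀ θ, HasDerivAt (fun θ => ρ * w θ) (polarField P₁ Pₙ n θ (ρ * w θ)) θ := by
  obtain ⟨S, hS0, hS⟩ := abs_barP_le P₁
  obtain ⟨ε, hε, H⟩ := exists_small_solution (a := fun _ => 1) (b := fun x => q.eval x)
    continuous_const q.continuous n hn hS0
  refine ⟨ε, hε, fun ρ hρ θ₀ => ?_⟩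
  have hmem : ∀ θ, barP P₁ θ ∈ Set.Ioo (-S) S := fun θ => abs_lt.1 (hS θ)
  obtain ⟨w, hw0, -, hw, hd⟩ := H ρ hρ (barP P₁ θ₀) (Set.Ioo_subset_Icc_self (hmem θ₀))
  refine ⟨fun θ => w (barP P₁ θ), hw0, fun θ => by linarith [(hw (barP P₁ θ)).1],
    fun θ => by simp only [barP_periodic θ], fun θ => ?_⟩
  convert! (hd _ (hmem θ)).comp θ (hasDerivAt_barP hP₁ θ) using 1
  rw [polarField, hq]
  ring

theorem isPolarCenter_of_factor (hn : 1 ≤ n) (hP₁ : P₁.IsHomogeneous 1) {q : Polynomial ℝ}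
    (hq : ∀ θ, onCircle Pₙ θ = onCircle P₁ θ * q.eval (barP P₁ θ)) :
    IsPolarCenter (polarField P₁ Pₙ n) := by
  obtain ⟨ε, hε, H⟩ := exists_periodic_solution hn hP₁ hq
  refine ⟨ε, hε, fun c hc => ?_⟩
  obtain ⟨w, hw0, -, hper, hd⟩ := H c hc 0
  exact ⟨fun θ => c * w θ, by simp [hw0], hd, fun θ => by simp only [hper θ]⟩

theorem eval_polar (hPₙ : Pₙ.IsHomogeneous n) (r θ : ℝ) :
    eval ![r * Real.cos θ, r * Real.sin θ] Pₙ = r ^ n * onCircle Pₙ θ :=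
  eval_smul_of_isHomogeneous hPₙ r _ _

theorem isPlanarCenter_of_factor (hn : 1 ≤ n) (hP₁ : P₁.IsHomogeneous 1)
    (hPₙ : Pₙ.IsHomogeneous n) {q : Polynomial ℝ}
    (hq : ∀ θ, onCircle Pₙ θ = onCircle P₁ θ * q.eval (barP P₁ θ)) :
    IsPlanarCenter (rigidField P₁ Pₙ) 0 := by
  obtain ⟨ε, hε, H⟩ := exists_periodic_solution hn hP₁ hq
  -- The ball is for the sup norm; the Euclidean radius is at most `|x| + |y| < ε`.
  refine ⟨by simp [rigidField], Metric.ball 0 (ε / 2), Metric.ball_mem_nhds _ (by positivity),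
    fun v hv hv0 => ?_⟩
  obtain ⟨ρ, φ, hρ0, hρε, hx, hy⟩ : ∃ ρ φ : ℝ, 0 < ρ ∧ ρ < ε ∧ ρ * Real.cos φ = v.1 ∧
      ρ * Real.sin φ = v.2 := by
    refine ⟨‖(⟨v.1, v.2⟩ : ℂ)‖, Complex.arg ⟨v.1, v.2⟩, ?_, ?_, Complex.norm_mul_cos_arg _,
      Complex.norm_mul_sin_arg _⟩
    · rw [norm_pos_iff]
      intro h
      apply hv0
      rw [Complex.ext_iff] at h
      exact Prod.ext h.1 h.2
    · rw [mem_ball_zero_iff, Prod.norm_def, max_lt_iff, Real.norm_eq_abs, Real.norm_eq_abs] at hv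
      have := Complex.norm_le_abs_re_add_abs_im ⟨v.1, v.2⟩
      simp only at this
      linarith
  obtain ⟨w, hw0, hw, hper, hd⟩ := H ρ (by rwa [abs_of_pos hρ0]) φ
  have hadd : ∀ t, HasDerivAt (fun t : ℝ => φ + t) 1 t := fun t => (hasDerivAt_id t).const_add φ
  refine ⟨fun t => (ρ * w (φ + t) * Real.cos (φ + t), ρ * w (φ + t) * Real.sin (φ + t)),
    2 * Real.pi, by positivity, ?_, fun t => ?_, fun t => ?_,
    fun t => ρ * w (φ + t), fun t => φ + t, by fun_prop,
    fun t => ⟨mul_pos hρ0 (hw _), by simp⟩, by simp [Real.pi_ne_zero]⟩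
  · simp [hw0, hx, hy]
  · have hr := (hd (φ + t)).comp t (hadd t)
    have hcos := (Real.hasDerivAt_cos (φ + t)).comp t (hadd t)
    have hsin := (Real.hasDerivAt_sin (φ + t)).comp t (hadd t)
    convert! (hr.mul hcos).prodMk (hr.mul hsin) using 1
    simp only [rigidField, polarField, eval_polar hP₁, eval_polar hPₙ, Function.comp]
    ext <;> simp only <;> ring
  · simp only [← add_assoc, hper (φ + t), Real.cos_add_two_pi, Real.sin_add_two_pi]

end Sufficiency

/-! ### Return after one turn -/

section FirstReturn

variable {P₁ Pₙ : MvPolynomial (Fin 2) ℝ} {n : ℕ}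

/-- The difference quotient of the polar field between `x` and `y`. -/
def polarSlope (P₁ Pₙ : MvPolynomial (Fin 2) ℝ) (n : ℕ) (θ x y : ℝ) : ℝ :=
  onCircle P₁ θ * (x + y) +
    onCircle Pₙ θ * ∑ i ∈ Finset.range (n + 1), x ^ i * y ^ (n + 1 - 1 - i)

theorem polarSlope_mul (P₁ Pₙ : MvPolynomial (Fin 2) ℝ) (n : ℕ) (θ x y : ℝ) :
    polarSlope P₁ Pₙ n θ x y * (x - y) = polarField P₁ Pₙ n θ x - polarField P₁ Pₙ n θ y := by
  simp only [polarSlope, polarField]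
  linear_combination onCircle Pₙ θ * (Commute.all x y).geom_sum₂_mul (n + 1)

theorem continuous_polarSlope {x y : ℝ → ℝ} (hx : Continuous x) (hy : Continuous y) :
    Continuous fun θ => polarSlope P₁ Pₙ n θ (x θ) (y θ) := by
  have h1 : Continuous (onCircle P₁) := continuous_onCircle P₁
  have hn : Continuous (onCircle Pₙ) := continuous_onCircle Pₙ
  unfold polarSlope
  fun_prop

theorem polarField_periodic (P₁ Pₙ : MvPolynomial (Fin 2) ℝ) (n : ℕ) :
    Function.Periodic (polarField P₁ Pₙ n) (2 * Real.pi) := fun θ => by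
  ext r
  simp only [polarField, onCircle_periodic _ θ]

/-- A solution of the polar equation that returns after `k ≥ 1` turns returns after one turn. -/
theorem eq_of_return {r : ℝ → ℝ} (hr : ∀ θ, HasDerivAt r (polarField P₁ Pₙ n θ (r θ)) θ) {k : ℕ}
    (hk : 0 < k) (hret : r (k * (2 * Real.pi)) = r 0) : r (2 * Real.pi) = r 0 := by
  have hrc : Continuous r := continuous_iff_continuousAt.2 fun θ => (hr θ).continuousAt
  have hshift : ∀ θ, HasDerivAt (fun θ => r (θ + 2 * Real.pi))
      (polarField P₁ Pₙ n θ (r (θ + 2 * Real.pi))) θ := fun θ => by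
    have := (hr (θ + 2 * Real.pi)).comp_add_const θ (2 * Real.pi)
    rwa [polarField_periodic] at this
  have hd := eq_exp_integral_of_hasDerivAt (d := fun θ => r (θ + 2 * Real.pi) - r θ)
    (h := fun θ => polarSlope P₁ Pₙ n θ (r (θ + 2 * Real.pi)) (r θ))
    (continuous_polarSlope (by fun_prop) hrc)
    (fun θ => by
      rw [polarSlope_mul]
      exact (hshift θ).sub (hr θ))
  -- The increments over successive turns are all `r (2π) - r 0` times a positive factor, and they
  -- telescope to `r (2πk) - r 0 = 0`.
  have hsum := Finset.sum_range_sub (fun i : ℕ => r (i * (2 * Real.pi))) k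
  have hterm : ∀ i : ℕ, r ((i + 1 : ℕ) * (2 * Real.pi)) - r (i * (2 * Real.pi)) =
      (r (2 * Real.pi) - r 0) * Real.exp (∫ τ in (0 : ℝ)..(i * (2 * Real.pi)),
        polarSlope P₁ Pₙ n τ (r (τ + 2 * Real.pi)) (r τ)) := fun i => by
    have := hd (i * (2 * Real.pi))
    simp only [zero_add] at this
    rw [← this]
    push_cast
    ring_nf
  simp only [hterm, ← Finset.mul_sum, Nat.cast_zero, zero_mul, hret, sub_self] at hsum
  have hpos := Finset.sum_pos (s := Finset.range k) (f := fun i : ℕ =>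
    Real.exp (∫ τ in (0 : ℝ)..(i * (2 * Real.pi)),
        polarSlope P₁ Pₙ n τ (r (τ + 2 * Real.pi)) (r τ))) (fun i _ => Real.exp_pos _)
    ⟨0, Finset.mem_range.2 hk⟩
  rcases mul_eq_zero.1 hsum with h | h
  · linarith
  · exact absurd h hpos.ne'

/-- The solutions of the polar equation with small positive initial value return after one turn. -/
def HasTrivialReturn (P₁ Pₙ : MvPolynomial (Fin 2) ℝ) (n : ℕ) : Prop :=
  ∃ ε > 0, ∀ c : ℝ, 0 < c → c < ε → ∃ r : ℝ → ℝ, r 0 = c ∧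
    (∀ θ, HasDerivAt r (polarField P₁ Pₙ n θ (r θ)) θ) ∧ r (2 * Real.pi) = c

theorem IsPolarCenter.hasTrivialReturn (h : IsPolarCenter (polarField P₁ Pₙ n)) :
    HasTrivialReturn P₁ Pₙ n := by
  obtain ⟨ε, hε, H⟩ := h
  refine ⟨ε, hε, fun c hc0 hc => ?_⟩
  obtain ⟨r, hr0, hr, hper⟩ := H c (by rwa [abs_of_pos hc0])
  exact ⟨r, hr0, hr, by rw [← hr0]; simpa using hper 0⟩

/-- The field turns with unit angular speed, so in the rotating frame an orbit starting on the
positive axis stays on it, and its coordinate `r` there solves the polar equation. The period is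
thus a multiple of `2π`, and `eq_of_return` reduces it to one turn. -/
theorem IsPlanarCenter.hasTrivialReturn (hP₁ : P₁.IsHomogeneous 1) (hPₙ : Pₙ.IsHomogeneous n)
    (h : IsPlanarCenter (rigidField P₁ Pₙ) 0) : HasTrivialReturn P₁ Pₙ n := by
  obtain ⟨-, U, hU, H⟩ := h
  obtain ⟨ε, hε, hball⟩ := Metric.mem_nhds_iff.1 hU
  refine ⟨ε, hε, fun c hc0 hc => ?_⟩
  obtain ⟨γ, T, hT, hγ0, hγ, hper, -⟩ := H (c, 0)
    (hball (by simp [Prod.norm_def, abs_of_pos hc0, hc, hε]))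
    (fun h => hc0.ne' (congrArg Prod.fst h))
  have hγc : Continuous γ := continuous_iff_continuousAt.2 fun t => (hγ t).continuousAt
  set κ : ℝ → ℝ := fun t => eval ![(γ t).1, (γ t).2] P₁ + eval ![(γ t).1, (γ t).2] Pₙ with hκ
  have hvec : Continuous fun t => ![(γ t).1, (γ t).2] := by
    refine continuous_pi fun i => ?_
    fin_cases i
    · exact hγc.fst
    · exact hγc.snd
  have hκc : Continuous κ :=
    ((MvPolynomial.continuous_eval P₁).comp hvec).add ((MvPolynomial.continuous_eval Pₙ).comp hvec)
  have h1 : ∀ t, HasDerivAt (fun t => (γ t).1) (-(γ t).2 + (γ t).1 * κ t) t := fun t =>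
    (ContinuousLinearMap.fst ℝ ℝ ℝ).hasFDerivAt.comp_hasDerivAt t (hγ t)
  have h2 : ∀ t, HasDerivAt (fun t => (γ t).2) ((γ t).1 + (γ t).2 * κ t) t := fun t =>
    (ContinuousLinearMap.snd ℝ ℝ ℝ).hasFDerivAt.comp_hasDerivAt t (hγ t)
  let r : ℝ → ℝ := fun t => (γ t).1 * Real.cos t + (γ t).2 * Real.sin t
  let y : ℝ → ℝ := fun t => -(γ t).1 * Real.sin t + (γ t).2 * Real.cos t
  have hr : ∀ t, HasDerivAt r (κ t * r t) t := fun t => by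
    convert! ((h1 t).mul (Real.hasDerivAt_cos t)).add ((h2 t).mul (Real.hasDerivAt_sin t)) using 1
    simp only [r]; ring
  have hy : ∀ t, HasDerivAt y (κ t * y t) t := fun t => by
    convert! ((h1 t).neg.mul (Real.hasDerivAt_sin t)).add
      ((h2 t).mul (Real.hasDerivAt_cos t)) using 1
    simp only [y, Pi.neg_apply]; ring
  have hr0 : r 0 = c := by simp [r, hγ0]
  have hy0 : ∀ t, y t = 0 := fun t => by
    rw [eq_exp_integral_of_hasDerivAt hκc hy t]
    simp [y, hγ0]
  have hrpos : ∀ t, 0 < r t := fun t => by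
    rw [eq_exp_integral_of_hasDerivAt hκc hr t, hr0]
    positivity
  have hfst : ∀ t, (γ t).1 = r t * Real.cos t := fun t => by
    have := hy0 t
    simp only [y] at this
    simp only [r]
    linear_combination (-(γ t).1) * Real.sin_sq_add_cos_sq t - Real.sin t * this
  have hsnd : ∀ t, (γ t).2 = r t * Real.sin t := fun t => by
    have := hy0 t
    simp only [y] at this
    simp only [r]
    linear_combination (-(γ t).2) * Real.sin_sq_add_cos_sq t + Real.cos t * this
  have hpolar : ∀ t, HasDerivAt r (polarField P₁ Pₙ n t (r t)) t := fun t => by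
    convert! hr t using 1
    simp only [hκ, hfst, hsnd, eval_polar hP₁, eval_polar hPₙ, polarField]
    ring
  have hγT : γ T = (c, 0) := by rw [← hγ0]; simpa using hper 0
  have hsin : Real.sin T = 0 := by
    have := hsnd T
    rw [hγT] at this
    exact (mul_eq_zero.1 this.symm).resolve_left (hrpos T).ne'
  have hcosT : r T * Real.cos T = c := by rw [← hfst, hγT]
  have hcos : Real.cos T = 1 := by
    rcases Real.sin_eq_zero_iff_cos_eq.1 hsin with h | h
    · exact h
    · rw [h] at hcosT
      linarith [hrpos T]
  obtain ⟨k, hk⟩ := (Real.cos_eq_one_iff T).1 hcos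
  have hk0 : 0 < k := by
    have : (0 : ℝ) < k := pos_of_mul_pos_left (hk ▸ hT) (by positivity)
    exact_mod_cast this
  lift k to ℕ using hk0.le
  rw [Int.cast_natCast] at hk
  refine ⟨r, hr0, hpolar, ?_⟩
  rw [eq_of_return hpolar (k := k) (by exact_mod_cast hk0), hr0]
  rw [hk, hr0, ← hcosT, hcos, mul_one]

end FirstReturn

/-! ### Asymptotic estimates for a returning solution -/

section Asymptotics

theorem exists_abs_one_sub_pow_sub_le (m : ℕ) :
    ∃ C ≥ 0, ∀ x : ℝ, |x| ≤ 1 → |(1 - x) ^ m - 1 + m * x| ≤ C * x ^ 2 := by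
  induction m with
  | zero => exact ⟨0, le_rfl, fun x _ => by simp⟩
  | succ m ih =>
    obtain ⟨C, hC, h⟩ := ih
    refine ⟨2 * C + m, by positivity, fun x hx => ?_⟩
    have e : (1 - x) ^ (m + 1) - 1 + (m + 1 : ℕ) * x =
        (1 - x) * ((1 - x) ^ m - 1 + m * x) + m * x ^ 2 := by
      push_cast; ring
    have h1 : |1 - x| ≤ 2 := by
      rw [abs_le] at hx ⊢; constructor <;> linarith
    calc |(1 - x) ^ (m + 1) - 1 + (m + 1 : ℕ) * x|
        ≤ |1 - x| * |(1 - x) ^ m - 1 + m * x| + m * x ^ 2 := by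
          rw [e]
          refine (abs_add_le _ _).trans_eq ?_
          rw [abs_mul, abs_of_nonneg (by positivity : 0 ≤ (m : ℝ) * x ^ 2)]
      _ ≤ 2 * (C * x ^ 2) + m * x ^ 2 := by
          gcongr
          exact h x hx
      _ = (2 * C + m) * x ^ 2 := by ring

/-- The powers of geometric sums approximate the negative powers of `1 - y`. -/
theorem exists_abs_geom_sum_pow_sub_le (n m : ℕ) :
    ∃ C ≥ 0, ∀ y : ℝ, |y| ≤ 1 / 2 →
      |(∑ j ∈ Finset.range (n + 1), y ^ j) ^ m - ((1 - y) ^ m)⁻¹| ≤ C * |y| ^ (n + 1) := by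
  obtain ⟨C, hC, h⟩ := exists_abs_one_sub_pow_sub_le m
  refine ⟨2 ^ m * (C + m), by positivity, fun y hy => ?_⟩
  have hσ : 1 / 2 ≤ 1 - y := by linarith [le_abs_self y]
  have hσ0 : 0 < 1 - y := by linarith
  set z := y ^ (n + 1) with hz
  have hz1 : |z| ≤ 1 := by
    rw [hz, abs_pow]
    exact pow_le_one₀ (abs_nonneg _) (by linarith)
  -- The geometric sum is `(1 - z) / (1 - y)`.
  have e : (∑ j ∈ Finset.range (n + 1), y ^ j) ^ m - ((1 - y) ^ m)⁻¹ =
      ((1 - y) ^ m)⁻¹ * ((1 - z) ^ m - 1) := by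
    rw [hz, ← geom_sum_mul_neg, mul_pow]
    field_simp
  have h1 : |(1 - z) ^ m - 1| ≤ (C + m) * |z| := by
    have h2 := h z hz1
    have h3 : z ^ 2 ≤ |z| := by rw [← sq_abs]; nlinarith [abs_nonneg z]
    have e' : (1 - z) ^ m - 1 = ((1 - z) ^ m - 1 + m * z) - m * z := by ring
    rw [e']
    refine (abs_sub _ _).trans ?_
    rw [abs_mul, Nat.abs_cast, add_mul]
    gcongr
    exact h2.trans (by gcongr)
  have h4 : ((1 - y) ^ m)⁻¹ ≤ 2 ^ m := by
    rw [← inv_pow]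
    gcongr
    rw [inv_le_comm₀ hσ0 two_pos]
    linarith
  rw [e, abs_mul, abs_of_pos (by positivity : 0 < ((1 - y) ^ m)⁻¹), ← abs_pow, ← hz, mul_assoc]
  gcongr

/-- The key estimate for a solution `δ ρ` of the polar equation that returns after time `τ`:
`e` is the rescaled deviation of its inverse from that of the equation with `p = 0`. -/
theorem exists_abs_integral_geom_sum_le {s p : ℝ → ℝ} (hs : Continuous s) (hp : Continuous p)
    {S M τ : ℝ} (hS0 : 0 < S) (hS : ∀ θ, |s θ| ≤ S) (hM0 : 0 < M) (hM : ∀ θ, |p θ| ≤ M)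
    (hτ : 0 < τ) (m : ℕ) :
    ∃ K : ℝ, ∃ δ₀ > 0, ∀ δ, 0 < δ → δ < δ₀ → ∀ e ρ : ℝ → ℝ, Continuous ρ →
      (∀ θ, HasDerivAt e (p θ * ρ θ ^ m) θ) → (∀ θ ∈ Set.Icc 0 τ, |ρ θ| ≤ 3) →
      (∀ θ, ρ θ * (1 - δ * s θ - δ ^ (m + 1) * e θ) = 1) → e 0 = 0 → e τ = 0 →
      |∫ θ in (0 : ℝ)..τ, p θ * (∑ j ∈ Finset.range (m + 2), (δ * s θ) ^ j) ^ m| ≤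
        K * δ ^ (m + 2) := by
  obtain ⟨C, hC0, hC⟩ := exists_abs_one_sub_pow_sub_le m
  obtain ⟨D, hD0, hD⟩ := exists_abs_geom_sum_pow_sub_le (m + 1) m
  set K₀ : ℝ := M * 3 ^ m with hK₀
  have hK₀pos : 0 < K₀ := by positivity
  set K₁ : ℝ := K₀ * τ with hK₁
  have hK₁pos : 0 < K₁ := by positivity
  set K : ℝ := M * (D * S ^ (m + 2)) + K₀ * (C * (2 * K₁) ^ 2 + m * (K₁ * (2 * S))) with hK
  refine ⟨K * τ, min (1 / (2 * S)) (min 1 (1 / (2 * K₁))), by positivity,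
    fun δ hδ0 hδ e ρ hρc he hρ hid he0 heτ => ?_⟩
  have hδ1 : δ * S ≤ 1 / 2 := by
    have := hδ.trans_le (min_le_left _ _)
    rw [lt_div_iff₀ (by positivity)] at this
    linarith
  have hδ2 : δ ≤ 1 := (hδ.trans_le ((min_le_right _ _).trans (min_le_left _ _))).le
  have hδ3 : δ * (2 * K₁) ≤ 1 := by
    have := hδ.trans_le ((min_le_right _ _).trans (min_le_right _ _))
    rw [lt_div_iff₀ (by positivity)] at this
    exact this.le
  have hec : Continuous e := continuous_iff_continuousAt.2 fun θ => (he θ).continuousAt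
  have he' : Continuous fun θ => p θ * ρ θ ^ m := by fun_prop
  have hbd : ∀ θ ∈ Set.Icc 0 τ, |p θ * ρ θ ^ m| ≤ K₀ := fun θ hθ => by
    rw [abs_mul, abs_pow, hK₀]
    gcongr
    · exact hM θ
    · exact hρ θ hθ
  have hebd : ∀ θ ∈ Set.Icc 0 τ, |e θ| ≤ K₁ := fun θ hθ => by
    have h1 := intervalIntegral.integral_eq_sub_of_hasDerivAt (fun t _ => he t)
      (he'.intervalIntegrable 0 θ)
    rw [he0, sub_zero] at h1
    rw [← h1, ← Real.norm_eq_abs]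
    refine (intervalIntegral.norm_integral_le_of_norm_le_const (C := K₀) fun t ht => ?_).trans ?_
    · rw [Set.uIoc_of_le hθ.1] at ht
      exact hbd t ⟨ht.1.le, ht.2.trans hθ.2⟩
    · rw [sub_zero, abs_of_nonneg hθ.1, hK₁]
      gcongr
      exact hθ.2
  have hI1 : ∫ θ in (0 : ℝ)..τ, p θ * ρ θ ^ m = 0 := by
    rw [intervalIntegral.integral_eq_sub_of_hasDerivAt (fun t _ => he t)
      (he'.intervalIntegrable 0 τ), he0, heτ, sub_zero]
  have hI2 : ∫ θ in (0 : ℝ)..τ, e θ * (p θ * ρ θ ^ m) = 0 := by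
    have := intervalIntegral.integral_comp_mul_deriv (a := 0) (b := τ) (g := fun x => x)
      (fun θ _ => he θ) he'.continuousOn continuous_id
    rw [he0, heτ, intervalIntegral.integral_same] at this
    exact this
  -- Both added terms integrate to zero; they make the integrand pointwise `O(δ^(m+2))`.
  have hI : ∫ θ in (0 : ℝ)..τ, p θ * (∑ j ∈ Finset.range (m + 2), (δ * s θ) ^ j) ^ m =
      ∫ θ in (0 : ℝ)..τ, (p θ * (∑ j ∈ Finset.range (m + 2), (δ * s θ) ^ j) ^ m -
        p θ * ρ θ ^ m + m * δ ^ (m + 1) * (e θ * (p θ * ρ θ ^ m))) := by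
    rw [intervalIntegral.integral_add, intervalIntegral.integral_sub, hI1,
      intervalIntegral.integral_const_mul, hI2]
    · ring
    all_goals exact Continuous.intervalIntegrable (by fun_prop) _ _
  rw [hI, ← Real.norm_eq_abs]
  refine (intervalIntegral.norm_integral_le_of_norm_le_const (C := K * δ ^ (m + 2))
    fun θ hθ => ?_).trans_eq (by rw [sub_zero, abs_of_pos hτ]; ring)
  rw [Set.uIoc_of_le hτ.le] at hθ
  have hθ' : θ ∈ Set.Icc 0 τ := Set.Ioc_subset_Icc_self hθ
  set y := δ * s θ with hy
  have hyS : |y| ≤ δ * S := by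
    rw [hy, abs_mul, abs_of_pos hδ0]
    gcongr
    exact hS θ
  have hy2 : |y| ≤ 1 / 2 := hyS.trans hδ1
  have hσ : 1 / 2 ≤ 1 - y := by linarith [le_abs_self y]
  have hσ0 : 0 < 1 - y := by linarith
  have hσinv : |(1 - y)⁻¹| ≤ 2 := by
    rw [abs_of_pos (by positivity), inv_le_comm₀ hσ0 two_pos]
    linarith
  -- The relative correction: `ρ (1 - x) = (1 - y)⁻¹`.
  set x := δ ^ (m + 1) * e θ * (1 - y)⁻¹ with hx
  have hxK : |x| ≤ δ ^ (m + 1) * (2 * K₁) := by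
    rw [hx, abs_mul, abs_mul, abs_of_pos (by positivity : 0 < δ ^ (m + 1))]
    calc δ ^ (m + 1) * |e θ| * |(1 - y)⁻¹| ≤ δ ^ (m + 1) * K₁ * 2 := by
          gcongr
          exact hebd θ hθ'
      _ = _ := by ring
  have hδm : δ ^ (m + 1) ≤ δ := pow_le_of_le_one hδ0.le hδ2 (by omega)
  have hx1 : |x| ≤ 1 := hxK.trans (le_trans (by gcongr) hδ3)
  have hpσ : p θ * ((1 - y) ^ m)⁻¹ = p θ * ρ θ ^ m * (1 - x) ^ m := by
    have h1 : ρ θ * (1 - x) = (1 - y)⁻¹ := by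
      rw [hx]
      field_simp
      exact hid θ
    rw [mul_assoc, ← mul_pow, h1, inv_pow]
  -- Three errors remain: truncating the geometric series, the quadratic remainder in `x`, and
  -- replacing `(1 - y)⁻¹` by `1` in the linear term, which gains a factor `y = O(δ)`.
  have e1 : p θ * (∑ j ∈ Finset.range (m + 2), y ^ j) ^ m - p θ * ρ θ ^ m +
      m * δ ^ (m + 1) * (e θ * (p θ * ρ θ ^ m)) =
      p θ * ((∑ j ∈ Finset.range (m + 2), y ^ j) ^ m - ((1 - y) ^ m)⁻¹) +
        p θ * ρ θ ^ m * (((1 - x) ^ m - 1 + m * x) +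
          m * (δ ^ (m + 1) * e θ * (-y * (1 - y)⁻¹))) := by
    have h2 : -y * (1 - y)⁻¹ = 1 - (1 - y)⁻¹ := by
      field_simp
      ring
    rw [h2, mul_sub (p θ), hpσ, hx]
    ring
  have hB1 := hD y hy2
  have hB2 := hC x hx1
  have hpow : |y| ^ (m + 2) ≤ S ^ (m + 2) * δ ^ (m + 2) := by
    rw [← mul_pow, mul_comm S]
    gcongr
  have hx2 : x ^ 2 ≤ (2 * K₁) ^ 2 * δ ^ (m + 2) := by
    rw [← sq_abs]
    calc |x| ^ 2 ≤ (δ ^ (m + 1) * (2 * K₁)) ^ 2 := by gcongr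
      _ = (2 * K₁) ^ 2 * (δ ^ (m + 2) * δ ^ m) := by ring
      _ ≤ (2 * K₁) ^ 2 * (δ ^ (m + 2) * 1) := by
          gcongr
          exact pow_le_one₀ hδ0.le hδ2
      _ = _ := by ring
  rw [e1, Real.norm_eq_abs]
  calc _ ≤ |p θ| * |(∑ j ∈ Finset.range (m + 2), y ^ j) ^ m - ((1 - y) ^ m)⁻¹| +
        |p θ * ρ θ ^ m| * (|(1 - x) ^ m - 1 + m * x| +
          m * (δ ^ (m + 1) * |e θ| * (|y| * |(1 - y)⁻¹|))) := by
        refine (abs_add_le _ _).trans ?_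
        rw [abs_mul (p θ) (_ - _), abs_mul (p θ * ρ θ ^ m)]
        gcongr
        refine (abs_add_le _ _).trans_eq ?_
        simp only [abs_mul, abs_neg, Nat.abs_cast, abs_pow, abs_of_pos hδ0]
    _ ≤ M * (D * (S ^ (m + 2) * δ ^ (m + 2))) +
        K₀ * (C * ((2 * K₁) ^ 2 * δ ^ (m + 2)) + m * (δ ^ (m + 1) * K₁ * ((δ * S) * 2))) := by
        gcongr
        · exact hM θ
        · exact hB1.trans (by gcongr)
        · exact hbd θ hθ'
        · exact hB2.trans (by gcongr)
        · exact hebd θ hθ'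
    _ = K * δ ^ (m + 2) := by rw [hK]; ring

/-- Letting `δ → 0` kills the constant term; dividing by `X` lowers `N` by one. -/
theorem Polynomial.coeff_eq_zero_of_abs_eval_le {R : Polynomial ℝ} {K δ₀ : ℝ} {N : ℕ}
    (hδ₀ : 0 < δ₀) (h : ∀ δ, 0 < δ → δ < δ₀ → |R.eval δ| ≤ K * δ ^ N) :
    ∀ j < N, R.coeff j = 0 := by
  induction N generalizing R with
  | zero => simp
  | succ N ih =>
    have h0 : R.coeff 0 = 0 := by
      rw [Polynomial.coeff_zero_eq_eval_zero, ← abs_eq_zero]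
      have hle : |R.eval 0| ≤ K * 0 ^ (N + 1) :=
        le_of_tendsto_of_tendsto (b := nhdsWithin 0 (Set.Ioi 0))
          (f := fun δ => |R.eval δ|) (g := fun δ => K * δ ^ (N + 1))
          (R.continuous.abs.tendsto 0 |>.mono_left nhdsWithin_le_nhds)
          ((by fun_prop : Continuous fun δ : ℝ => K * δ ^ (N + 1)).tendsto 0
            |>.mono_left nhdsWithin_le_nhds)
          (by
            filter_upwards [Ioo_mem_nhdsGT hδ₀] with δ hδ
            exact h δ hδ.1 hδ.2)
      rw [zero_pow (by omega), mul_zero] at hle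
      exact le_antisymm hle (abs_nonneg _)
    have hdiv : R.divX * Polynomial.X = R := by
      have := R.divX_mul_X_add
      rwa [h0, map_zero, add_zero] at this
    have hd := ih (R := R.divX) fun δ hδ0 hδ => by
      have h1 := h δ hδ0 hδ
      rw [← hdiv, Polynomial.eval_mul, Polynomial.eval_X, abs_mul, abs_of_pos hδ0, pow_succ,
        ← mul_assoc] at h1
      exact le_of_mul_le_mul_right h1 hδ0
    intro j hj
    cases j with
    | zero => exact h0
    | succ j =>
      rw [← Polynomial.coeff_divX]
      exact hd j (by omega)

/-- The polynomial `(1 + X + ⋯ + X ^ n) ^ m`. -/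
def geomPow (n m : ℕ) : Polynomial ℝ := (∑ j ∈ Finset.range (n + 1), Polynomial.X ^ j) ^ m

theorem geomPow_eval (n m : ℕ) (x : ℝ) :
    (geomPow n m).eval x = (∑ j ∈ Finset.range (n + 1), x ^ j) ^ m := by
  simp [geomPow, Polynomial.eval_finsetSum]

theorem geomPow_coeff_nonneg (n m j : ℕ) : 0 ≤ (geomPow n m).coeff j := by
  induction m generalizing j with
  | zero => simp only [geomPow, pow_zero, Polynomial.coeff_one]; split_ifs <;> norm_num
  | succ m ih =>
    rw [geomPow, pow_succ, Polynomial.coeff_mul]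
    refine Finset.sum_nonneg fun x _ => mul_nonneg (ih _) ?_
    rw [Polynomial.finsetSum_coeff]
    refine Finset.sum_nonneg fun i _ => ?_
    rw [Polynomial.coeff_X_pow]
    split_ifs <;> norm_num

/-- One factor supplies `X ^ j`, the others their constant term `1`, and nothing cancels. -/
theorem geomPow_coeff_pos (n m : ℕ) {j : ℕ} (hj : j ≤ n) : 0 < (geomPow n (m + 1)).coeff j := by
  have h0 : (geomPow n m).coeff 0 = 1 := by
    rw [Polynomial.coeff_zero_eq_eval_zero, geomPow_eval, Finset.sum_range_succ']
    simp
  rw [geomPow, pow_succ, Polynomial.coeff_mul]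
  refine Finset.sum_pos' (fun x _ => mul_nonneg (geomPow_coeff_nonneg n m _) ?_)
    ⟨(0, j), by simp, ?_⟩
  · rw [Polynomial.finsetSum_coeff]
    refine Finset.sum_nonneg fun i _ => ?_
    rw [Polynomial.coeff_X_pow]
    split_ifs <;> norm_num
  · change 0 < (geomPow n m).coeff 0 * _
    rw [h0, one_mul, Polynomial.finsetSum_coeff]
    simp only [Polynomial.coeff_X_pow]
    rw [Finset.sum_ite_eq, if_pos (Finset.mem_range.2 (by omega))]
    exact one_pos

end Asymptotics

/-! ### A center forces the moments to vanish -/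

section Necessity

variable {P₁ Pₙ : MvPolynomial (Fin 2) ℝ} {n : ℕ}

/-- The returning solution must coincide on `[0, 2π]` with the one from `exists_small_solution`,
which carries the bound: their difference solves a linear equation and starts at zero. -/
theorem HasTrivialReturn.exists_bounded (hn : 1 ≤ n) (h : HasTrivialReturn P₁ Pₙ n) :
    ∃ ε > 0, ∀ c : ℝ, 0 < c → c < ε → ∃ r : ℝ → ℝ, r 0 = c ∧
      (∀ θ, HasDerivAt r (polarField P₁ Pₙ n θ (r θ)) θ) ∧ r (2 * Real.pi) = c ∧
      (∀ θ, 0 < r θ) ∧ ∀ θ ∈ Set.Icc 0 (2 * Real.pi), r θ ≤ 3 / 2 * c := by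
  obtain ⟨ε₁, hε₁, H₁⟩ := h
  have hL : 0 < 2 * Real.pi + 1 := by positivity
  obtain ⟨ε₂, hε₂, H₂⟩ := exists_small_solution (continuous_onCircle P₁) (continuous_onCircle Pₙ)
    n hn hL
  refine ⟨min ε₁ ε₂, by positivity, fun c hc0 hc => ?_⟩
  obtain ⟨r, hr0, hr, hret⟩ := H₁ c hc0 (hc.trans_le (min_le_left _ _))
  obtain ⟨w, hw0, hwc, hw, hdw⟩ := H₂ c (by
    rw [abs_of_pos hc0]
    exact hc.trans_le (min_le_right _ _)) 0 ⟨by linarith, hL.le⟩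
  have hrc : Continuous r := continuous_iff_continuousAt.2 fun θ => (hr θ).continuousAt
  have hP₁ := continuous_onCircle P₁
  have hPₙ := continuous_onCircle Pₙ
  refine ⟨r, hr0, hr, hret, fun θ => ?_, fun θ hθ => ?_⟩
  · rw [eq_exp_integral_of_hasDerivAt (d := r)
      (h := fun θ => onCircle P₁ θ * r θ + onCircle Pₙ θ * r θ ^ n) (by fun_prop)
      (fun θ => by rw [mul_comm]; exact hr θ) θ, hr0]
    positivity
  · have heq := eq_exp_integral_of_hasDerivAt_Ioo (d := fun θ => r θ - c * w θ)
      (h := fun θ => polarSlope P₁ Pₙ n θ (r θ) (c * w θ)) (L := 2 * Real.pi + 1)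
      (continuous_polarSlope hrc (by fun_prop))
      (fun θ hθ => by
        rw [polarSlope_mul]
        exact (hr θ).sub (hdw θ hθ)) (t := θ)
      ⟨by linarith [hθ.1], by linarith [hθ.2]⟩
    simp only [hr0, hw0, mul_one, sub_self, zero_mul] at heq
    rw [sub_eq_zero.1 heq, mul_comm]
    gcongr
    exact (hw θ).2

theorem HasTrivialReturn.moment_eq_zero (hn : 2 ≤ n) (hP₁ : P₁.IsHomogeneous 1)
    (h : HasTrivialReturn P₁ Pₙ n) : ∀ j ≤ n, moment P₁ Pₙ j = 0 := by
  obtain ⟨m, rfl⟩ : ∃ m, n = m + 2 := ⟨n - 2, by omega⟩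
  obtain ⟨ε, hε, H⟩ := h.exists_bounded (by omega)
  obtain ⟨S, hS0, hS⟩ := abs_barP_le P₁
  obtain ⟨M, hM0, hM⟩ := exists_abs_onCircle_le Pₙ
  obtain ⟨K, δ₀, hδ₀, hK⟩ := exists_abs_integral_geom_sum_le (continuous_barP (P₁ := P₁))
    (continuous_onCircle Pₙ) hS0 (fun θ => (hS θ).le) hM0 hM Real.two_pi_pos (m + 1)
  have hest : ∀ δ, 0 < δ → δ < min δ₀ (min (ε / 2) (1 / (2 * S))) →
      |∫ θ in (0 : ℝ)..(2 * Real.pi),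
        (geomPow (m + 2) (m + 1)).eval (δ * barP P₁ θ) * onCircle Pₙ θ| ≤ K * δ ^ (m + 3) := by
    intro δ hδ0 hδ
    have hδ1 : δ < ε / 2 := hδ.trans_le ((min_le_right _ _).trans (min_le_left _ _))
    have hδ2 : δ * S < 1 / 2 := by
      have := hδ.trans_le ((min_le_right _ _).trans (min_le_right _ _))
      rw [lt_div_iff₀ (by positivity)] at this
      linarith
    have hs0 : |δ * barP P₁ 0| < 1 / 2 := by
      rw [abs_mul, abs_of_pos hδ0]
      exact (mul_le_mul_of_nonneg_left (hS 0).le hδ0.le).trans_lt hδ2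
    rw [abs_lt] at hs0
    have hden : 1 / 2 < 1 - δ * barP P₁ 0 := by linarith
    have hden0 : 0 < 1 - δ * barP P₁ 0 := by linarith
    have hc2 : δ / (1 - δ * barP P₁ 0) ≤ 2 * δ := by
      rw [div_le_iff₀ hden0]
      nlinarith
    -- This initial value has inverse `1/δ - s(0)`, so the deviation starts at zero. It is at most
    -- `2 δ`, whence `r ≤ 3 δ` over the turn.
    obtain ⟨r, hr0, hr, hret, hrpos, hrle⟩ := H (δ / (1 - δ * barP P₁ 0)) (by positivity)
      (by linarith)
    have hrc : Continuous r := continuous_iff_continuousAt.2 fun θ => (hr θ).continuousAt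
    have hsper : barP P₁ (2 * Real.pi) = barP P₁ 0 := by simpa using barP_periodic (P₁ := P₁) 0
    have hinit : δ⁻¹ - barP P₁ 0 - (δ / (1 - δ * barP P₁ 0))⁻¹ = 0 := by
      field_simp
      ring
    have := hK δ hδ0 (hδ.trans_le (min_le_left _ _))
      (fun θ => (δ⁻¹ - barP P₁ θ - (r θ)⁻¹) / δ ^ (m + 1)) (fun θ => r θ / δ) (by fun_prop)
      (fun θ => by
        have hrθ := (hrpos θ).ne'
        convert! (((hasDerivAt_barP hP₁ θ).const_sub δ⁻¹).sub ((hr θ).inv hrθ)).div_const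
          (δ ^ (m + 1)) using 1
        rw [polarField, div_pow]
        field_simp
        ring)
      (fun θ hθ => by
        rw [abs_of_pos (div_pos (hrpos θ) hδ0), div_le_iff₀ hδ0]
        linarith [hrle θ hθ])
      (fun θ => by
        have hrθ := (hrpos θ).ne'
        field_simp
        ring)
      (by rw [hr0, hinit, zero_div]) (by rw [hret, hsper, hinit, zero_div])
    simpa only [geomPow_eval, mul_comm (onCircle Pₙ _)] using this
  -- As a function of `δ`, the integral is the polynomial `R`, whose coefficients are the moments
  -- weighted by those of `geomPow`.
  let N := (geomPow (m + 2) (m + 1)).natDegree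
  let R : Polynomial ℝ := ∑ j ∈ Finset.range (N + 1),
    Polynomial.monomial j ((geomPow (m + 2) (m + 1)).coeff j * moment P₁ Pₙ j)
  have hR : ∀ δ, R.eval δ = ∫ θ in (0 : ℝ)..(2 * Real.pi),
      (geomPow (m + 2) (m + 1)).eval (δ * barP P₁ θ) * onCircle Pₙ θ := by
    intro δ
    have hs : Continuous (barP P₁) := continuous_barP
    have hp := continuous_onCircle Pₙ
    simp_rw [R, Polynomial.eval_finsetSum, Polynomial.eval_monomial, Polynomial.eval_eq_sum_range,
      Finset.sum_mul]
    rw [intervalIntegral.integral_finsetSum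
      (fun j _ => Continuous.intervalIntegrable (by fun_prop) _ _)]
    refine Finset.sum_congr rfl fun j _ => ?_
    rw [moment, mul_right_comm, ← intervalIntegral.integral_const_mul]
    congr 1
    ext θ
    ring
  intro j hj
  have hcoeff := Polynomial.coeff_eq_zero_of_abs_eval_le (R := R) (K := K) (N := m + 3)
    (δ₀ := min δ₀ (min (ε / 2) (1 / (2 * S)))) (by positivity)
    (fun δ hδ0 hδ => by rw [hR]; exact hest δ hδ0 hδ) j (by omega)
  have hpos := geomPow_coeff_pos (m + 2) m hj
  have hjN : j ∈ Finset.range (N + 1) :=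
    Finset.mem_range.2 (Nat.lt_succ_of_le (Polynomial.le_natDegree_of_ne_zero hpos.ne'))
  simp only [R, Polynomial.finsetSum_coeff, Polynomial.coeff_monomial] at hcoeff
  rw [Finset.sum_ite_eq' , if_pos hjN] at hcoeff
  exact (mul_eq_zero.1 hcoeff).resolve_left hpos.ne'

end Necessity

/-! ### Assembly of the center criteria -/

section MainTheorem

variable {P₁ Pₙ : MvPolynomial (Fin 2) ℝ} {n : ℕ}

theorem isPlanarCenter_iff (hn : 2 ≤ n) (hP₁ : P₁.IsHomogeneous 1) (hP₁_ne : P₁ ≠ 0)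
    (hPₙ : Pₙ.IsHomogeneous n) :
    IsPlanarCenter (rigidField P₁ Pₙ) 0 ↔ ∀ j ≤ n, moment P₁ Pₙ j = 0 := by
  refine ⟨fun h => (h.hasTrivialReturn hP₁ hPₙ).moment_eq_zero hn hP₁, fun h => ?_⟩
  obtain ⟨q, hq⟩ := exists_onCircle_eq_mul_of_moment_eq_zero hP₁ hP₁_ne hPₙ h
  exact isPlanarCenter_of_factor (by omega) hP₁ hPₙ hq

theorem isPolarCenter_iff (hn : 2 ≤ n) (hP₁ : P₁.IsHomogeneous 1) (hP₁_ne : P₁ ≠ 0)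
    (hPₙ : Pₙ.IsHomogeneous n) :
    IsPolarCenter (polarField P₁ Pₙ n) ↔ ∀ j ≤ n, moment P₁ Pₙ j = 0 := by
  refine ⟨fun h => h.hasTrivialReturn.moment_eq_zero hn hP₁, fun h => ?_⟩
  obtain ⟨q, hq⟩ := exists_onCircle_eq_mul_of_moment_eq_zero hP₁ hP₁_ne hPₙ h
  exact isPolarCenter_of_factor (by omega) hP₁ hq

theorem forall_moment_iff_odd {m : ℕ} (hPₙ : Pₙ.IsHomogeneous (2 * m + 1)) :
    (∀ j ≤ 2 * m + 1, moment P₁ Pₙ j = 0) ↔ ∀ j ≤ m, moment P₁ Pₙ (2 * j + 1) = 0 := by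
  refine ⟨fun h j hj => h _ (by omega), fun h j hj => ?_⟩
  rcases Nat.even_or_odd' j with ⟨i, rfl | rfl⟩
  · exact moment_eq_zero_of_parity_ne hPₙ (by omega)
  · exact h i (by omega)

theorem forall_moment_iff_even {m : ℕ} (hPₙ : Pₙ.IsHomogeneous (2 * m)) :
    (∀ j ≤ 2 * m, moment P₁ Pₙ j = 0) ↔ ∀ j ≤ m, moment P₁ Pₙ (2 * j) = 0 := by
  refine ⟨fun h j hj => h _ (by omega), fun h j hj => ?_⟩
  rcases Nat.even_or_odd' j with ⟨i, rfl | rfl⟩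
  · exact h i (by omega)
  · exact moment_eq_zero_of_parity_ne hPₙ (by omega)

theorem compositionCondition_of_factor (hP₁ : P₁.IsHomogeneous 1) {q : Polynomial ℝ}
    (hq : ∀ θ, onCircle Pₙ θ = onCircle P₁ θ * q.eval (barP P₁ θ)) :
    CompositionCondition ![onCircle P₁, onCircle Pₙ] := by
  refine ⟨barP P₁, fun θ => (hasDerivAt_barP hP₁ θ).differentiableAt, barP_periodic,
    ![fun _ => 1, fun x => q.eval x], fun i => ?_⟩
  fin_cases i
  · exact ⟨continuous_const, fun θ => by simp [(hasDerivAt_barP hP₁ θ).deriv]⟩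
  · exact ⟨q.continuous, fun θ => by simp [(hasDerivAt_barP hP₁ θ).deriv, hq]⟩

end MainTheorem

end

theorem theorem2p1 (n : ℕ) (hn : 2 ≤ n) (P₁ Pₙ : MvPolynomial (Fin 2) ℝ)
    (hP₁ : P₁.IsHomogeneous 1) (hP₁_ne : P₁ ≠ 0) (hPₙ : Pₙ.IsHomogeneous n) :
    -- the center conditions, for the planar system and for its polar equation
    (IsPlanarCenter (rigidField P₁ Pₙ) 0 ↔ ∀ j ≤ n, moment P₁ Pₙ j = 0) ∧
    (IsPolarCenter (polarField P₁ Pₙ n) ↔ ∀ j ≤ n, moment P₁ Pₙ j = 0) ∧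
    -- odd `n`
    (∀ m, n = 2 * m + 1 →
      (IsPlanarCenter (rigidField P₁ Pₙ) 0 ↔ ∀ j ≤ m, moment P₁ Pₙ (2 * j + 1) = 0) ∧
      (IsPolarCenter (polarField P₁ Pₙ n) ↔ ∀ j ≤ m, moment P₁ Pₙ (2 * j + 1) = 0)) ∧
    -- even `n`
    (∀ m, n = 2 * m →
      (IsPlanarCenter (rigidField P₁ Pₙ) 0 ↔ ∀ j ≤ m, moment P₁ Pₙ (2 * j) = 0) ∧
      (IsPolarCenter (polarField P₁ Pₙ n) ↔ ∀ j ≤ m, moment P₁ Pₙ (2 * j) = 0)) ∧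
    -- the moments of the other parity vanish, which leaves `⌊n/2⌋ + 1` conditions
    (∀ j, j % 2 ≠ n % 2 → moment P₁ Pₙ j = 0) ∧
    ((Finset.range (n + 1)).filter (fun j => j % 2 = n % 2)).card = n / 2 + 1 ∧
    -- the composition condition in the center case
    (IsPolarCenter (polarField P₁ Pₙ n) →
      CompositionCondition ![onCircle P₁, onCircle Pₙ] ∧
      ∃ q : Polynomial ℝ, ∀ θ, onCircle Pₙ θ = deriv (barP P₁) θ * q.eval (barP P₁ θ)) := by
  have hplanar := isPlanarCenter_iff hn hP₁ hP₁_ne hPₙ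
  have hpolar := isPolarCenter_iff hn hP₁ hP₁_ne hPₙ
  refine ⟨hplanar, hpolar, ?_, ?_, fun j hj => moment_eq_zero_of_parity_ne hPₙ hj,
    card_filter_parity n, fun h => ?_⟩
  · rintro m rfl
    rw [hplanar, hpolar, forall_moment_iff_odd hPₙ]
    exact ⟨Iff.rfl, Iff.rfl⟩
  · rintro m rfl
    rw [hplanar, hpolar, forall_moment_iff_even hPₙ]
    exact ⟨Iff.rfl, Iff.rfl⟩
  · obtain ⟨q, hq⟩ := exists_onCircle_eq_mul_of_moment_eq_zero hP₁ hP₁_ne hPₙ (hpolar.1 h)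
    exact ⟨compositionCondition_of_factor hP₁ hq, q, fun θ => by
      rw [(hasDerivAt_barP hP₁ θ).deriv, hq]⟩
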